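/- Let $n\ge 1$ be an integer, $s>5/2$ real and $T\in(0,\infty]$. Let $u\in C([0,T);H^s(\mathbb{R}))\cap C^1([0,T);H^{s-1}(\mathbb{R}))$ be a real-valued strong solution of the generalized higher-order Camassa–Holm (HOCH) equation $$m_t+(u^2-u_x^2)^{n-1}u_x\,m+\partial_x\big[(u^2-u_x^2)^{n-1}u\,m\big]=0,\qquad m=u-u_{xx},$$ where the equation is understood, at every time $t\in[0,T)$, in the sense of distributions in $x\in\mathbb{R}$, and $u(t,\cdot)$ denotes the continuous representative. Then for every $t\in[0,T)$ the function $$u^{2n+1}+\sum_{k=1}^{n}\frac{(-1)^{k+1}}{2k-1}\binom{n}{k}u^{2n-2k+1}u_x^{2k}$$ is integrable on $\mathbb{R}$ at time $t$, and the functional $$H_2(u)=\int_{\mathbb{R}}\Big(u^{2n+1}+\sum_{k=1}^{n}\frac{(-1)^{k+1}}{2k-1}\binom{n}{k}u^{2n-2k+1}u_x^{2k}\Big)\,dx$$ is independent of time: $H_2(u(t,\cdot))=H_2(u(0,\cdot))$ for all $t\in[0,T)$. -/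

import Mathlib

open MeasureTheory TemperedDistribution
open scoped SchwartzMap ContDiff

noncomputable section

namespace HOCH

/-- The time interval `[0, T)`, where `T` may be `∞`. -/
def timeInterval (T : EReal) : Set ℝ := {t : ℝ | 0 ≤ t ∧ (t : EReal) < T}

/-- `t ↦ u t` belongs to `C^k(I; H^σ(ℝ))` (used with `σ ≥ 0`). The Bessel potential of order `σ` is
an isometric isomorphism of `H^σ` onto `L²`, so this says that each `u t` is an `L²` function
whose Bessel potential of order `σ` is some `F t ∈ L²`, and that the curve `F` is `C^k` on `I`
in the `L²` norm (with one-sided derivatives at an end point of `I`). -/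
def IsSobolevCurve (k : ℕ) (σ : ℝ) (I : Set ℝ) (u : ℝ → ℝ → ℝ) : Prop :=
  ∃ F : ℝ → Lp ℂ 2 (volume : Measure ℝ), ContDiffOn ℝ k F I ∧
    ∀ t ∈ I, ∃ h : MemLp (fun x : ℝ => (u t x : ℂ)) 2 volume,
      besselPotential ℝ ℂ σ (h.toLp (fun x : ℝ => (u t x : ℂ)) : 𝓢'(ℝ, ℂ)) = (F t : 𝓢'(ℝ, ℂ))

/-- The momentum density `m = f - f_xx`. -/
def momentum (f : ℝ → ℝ) (x : ℝ) : ℝ := f x - deriv (deriv f) x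

/-- Strong solutions `u ∈ C([0,T); H^s) ∩ C¹([0,T); H^(s-1))` of
`m_t + (u² - u_x²)^(n-1) u_x m + ∂_x [(u² - u_x²)^(n-1) u m] = 0`, `m = u - u_xx`. -/
structure IsStrongSolution (n : ℕ) (s : ℝ) (T : EReal) (u : ℝ → ℝ → ℝ) : Prop where
  /-- `u t` is the continuous representative of its class in `H^s`. -/
  continuous_space : ∀ t ∈ timeInterval T, Continuous (u t)
  continuous_Hs : IsSobolevCurve 0 s (timeInterval T) u
  contDiff_Hs_sub_one : IsSobolevCurve 1 (s - 1) (timeInterval T) u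
  /-- For `s < 3` the terms `m_t` and `∂_x [...]` are only distributions in `x` (elements of
  `H^(s-3)`), so the equation at time `t` is tested against smooth functions of `x` with compact
  support. -/
  equation : ∀ t ∈ timeInterval T, ∀ φ : ℝ → ℝ, ContDiff ℝ ∞ φ → HasCompactSupport φ →
    HasDerivWithinAt (fun τ => ∫ x, momentum (u τ) x * φ x)
      (-(∫ x, (u t x ^ 2 - deriv (u t) x ^ 2) ^ (n - 1) * deriv (u t) x * momentum (u t) x * φ x)
        + ∫ x, (u t x ^ 2 - deriv (u t) x ^ 2) ^ (n - 1) * u t x * momentum (u t) x * deriv φ x)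
      (timeInterval T) t

/-- The density of `H₂`. -/
def H2density (n : ℕ) (f : ℝ → ℝ) (x : ℝ) : ℝ :=
  f x ^ (2 * n + 1) + ∑ k ∈ Finset.Icc 1 n,
    (-1 : ℝ) ^ (k + 1) / (2 * (k : ℝ) - 1) * (n.choose k : ℝ)
      * f x ^ (2 * n - 2 * k + 1) * deriv f x ^ (2 * k)

/-- The functional `H₂`. -/
def H2 (n : ℕ) (f : ℝ → ℝ) : ℝ := ∫ x, H2density n f x

end HOCH

end

/-! Write `A = u² - u_x²` and let `E = Aⁿ + 2n Aⁿ⁻¹ u m` be the variational derivative of `H₂`.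
Since `∂_x Aⁿ = 2n Aⁿ⁻¹ u_x m`, the equation is `m_t = -c E_x` with `c = 1/(2n)` (`weak_form_eq`).
For `v = u_t` this reads `v - v_xx = -c E_x`, so `w = v_x - cE` satisfies `w_x = v`. Hence `E v = (v
v_x - w w_x)/c` is an exact derivative and `dH₂/dt = ∫ E v = 0` (`integral_mul_eq_zero_of_weak_eq`).

That `E` is the variational derivative is algebra: the density `P(a, b)` satisfies `P - b P_b = a
(a² - b²)ⁿ`, and the derivatives of this identity in `a` and `b` give `P_a - ∂_x P_b = E`
(`hasDerivAt_densityPolySnd`).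

The analysis has two sides. The Fourier representation of `H^s` gives `u ∈ C²` with `u, u_x, u_xx ∈
L²`, and `v ∈ C¹` with `v, v_x ∈ L²`. The functional is differentiated in time by a second-order
Taylor estimate, as `(u, u_x)` is a differentiable `L²` curve with a local uniform bound and `P`
vanishes to second order at the origin (`hasDerivWithinAt_integral_comp`). -/

noncomputable section

namespace HOCH

open FourierTransform Real Filter Topology

/-! ### Fourier multipliers on `L²` and their pointwise values -/

/-- The Fourier multiplier with bounded symbol `a`, as an operator on `L²`. -/
def fourierMultiplierL2 (a : Lp ℂ ⊤ (volume : Measure ℝ)) :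
    Lp ℂ 2 (volume : Measure ℝ) →L[ℂ] Lp ℂ 2 (volume : Measure ℝ) :=
  ((Lp.fourierTransformₗᵢ ℝ ℂ).symm : Lp ℂ 2 (volume : Measure ℝ) →L[ℂ] Lp ℂ 2 volume) ∘L
    ((ContinuousLinearMap.mul ℂ ℂ).holderL volume ⊤ 2 2 a) ∘L
    ((Lp.fourierTransformₗᵢ ℝ ℂ) : Lp ℂ 2 (volume : Measure ℝ) →L[ℂ] Lp ℂ 2 volume)

theorem fourierMultiplierL2_apply (a : Lp ℂ ⊤ (volume : Measure ℝ))
    (G : Lp ℂ 2 (volume : Measure ℝ)) :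
    fourierMultiplierL2 a G = 𝓕⁻ ((ContinuousLinearMap.mul ℂ ℂ).holder 2 a (𝓕 G)) := rfl

theorem continuous_fourierInv {f : ℝ → ℂ} (hf : Integrable f) : Continuous (𝓕⁻ f) :=
  VectorFourier.fourierIntegral_continuous (L := -innerₗ ℝ) Real.continuous_fourierChar
    (by simp; fun_prop) hf

/-- On `L¹ ∩ L²` the inverse Fourier transform of `L²` is given by the Fourier integral. -/
theorem coeFn_fourierInv_of_integrable (h : Lp ℂ 2 (volume : Measure ℝ)) (hh : Integrable h) :
    (𝓕⁻ h : Lp ℂ 2 (volume : Measure ℝ)) =ᵐ[volume] 𝓕⁻ (h : ℝ → ℂ) := by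
  apply ae_eq_of_integral_contDiff_smul_eq
  · exact (Lp.memLp _).locallyIntegrable (by norm_num)
  · exact (continuous_fourierInv hh).locallyIntegrable
  · intro g g_smooth g_cpt
    have hg₁ : HasCompactSupport (Complex.ofRealCLM ∘ g) := g_cpt.comp_left rfl
    have hg₂ : ContDiff ℝ ∞ (Complex.ofRealCLM ∘ g) := by fun_prop
    have hg₃ : Integrable (Complex.ofRealCLM ∘ g) :=
      hg₂.continuous.integrable_of_hasCompactSupport hg₁
    -- As distributions, the `L²` transform moves onto the test function; for the Fourier integral,
    -- Fubini does the same.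
    have key : ((𝓕⁻ h : Lp ℂ 2 (volume : Measure ℝ)) : 𝓢'(ℝ, ℂ)) (hg₁.toSchwartzMap hg₂)
        = (h : 𝓢'(ℝ, ℂ)) (𝓕⁻ (hg₁.toSchwartzMap hg₂)) := by
      rw [← Lp.fourierInv_toTemperedDistribution_eq]; rfl
    rw [Lp.toTemperedDistribution_apply, Lp.toTemperedDistribution_apply] at key
    have e1 : ∀ x, (hg₁.toSchwartzMap hg₂) x = (g x : ℂ) := fun x => rfl
    simp only [e1, smul_eq_mul, SchwartzMap.fourierInv_coe] at key
    simp only [Complex.real_smul]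
    rw [key]
    have flip := VectorFourier.integral_fourierIntegral_smul_eq_flip (L := -innerₗ ℝ)
      Real.continuous_fourierChar (by simp; fun_prop) hg₃ hh
    have hL : (-innerₗ ℝ).flip = -innerₗ ℝ := by
      ext; simp
    rw [hL] at flip
    exact flip

theorem hasDerivAt_fourierInv {f : ℝ → ℂ} (hf : Integrable f)
    (hf' : Integrable fun ξ : ℝ => (2 * π * Complex.I * ξ) * f ξ) (x : ℝ) :
    HasDerivAt (𝓕⁻ f) (𝓕⁻ (fun ξ : ℝ => (2 * π * Complex.I * ξ) * f ξ) x) x := by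
  have h1 : Integrable (fun x : ℝ ↦ x • f x) := by
    have := hf'.const_mul (2 * π * Complex.I)⁻¹
    refine this.congr (Filter.Eventually.of_forall fun ξ => ?_)
    have : (2 * π * Complex.I : ℂ) ≠ 0 := by simp [Real.pi_ne_zero]
    simp only [Complex.real_smul]
    field_simp
  have h2 := (hasDerivAt_fourier hf h1 (-x)).scomp x (hasDerivAt_neg x)
  have h3 : 𝓕⁻ f = 𝓕 f ∘ Neg.neg := by
    ext y; exact fourierInv_eq_fourier_neg f y
  rw [h3, fourierInv_eq_fourier_neg]
  convert! h2 using 1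
  rw [Real.fourier_eq, Real.fourier_eq, ← integral_smul]
  congr 1
  ext ξ
  simp only [smul_eq_mul, Circle.smul_def, neg_smul, one_smul]
  ring

/-- A Fourier multiplier with symbol in `L² ∩ L^∞`, evaluated pointwise. -/
def multiplierFun (a : ℝ → ℂ) (G : Lp ℂ 2 (volume : Measure ℝ)) : ℝ → ℂ :=
  𝓕⁻ fun ξ => a ξ * (𝓕 G : Lp ℂ 2 (volume : Measure ℝ)) ξ

theorem integrable_mul_fourier {a : ℝ → ℂ} (ha : MemLp a 2)
    (G : Lp ℂ 2 (volume : Measure ℝ)) :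
    Integrable fun ξ => a ξ * (𝓕 G : Lp ℂ 2 (volume : Measure ℝ)) ξ :=
  ha.integrable_mul (Lp.memLp _)

theorem continuous_multiplierFun {a : ℝ → ℂ} (ha : MemLp a 2)
    (G : Lp ℂ 2 (volume : Measure ℝ)) : Continuous (multiplierFun a G) :=
  continuous_fourierInv (integrable_mul_fourier ha G)

theorem coeFn_fourierMultiplierL2 {a : ℝ → ℂ} (ha : MemLp a ⊤) (ha₂ : MemLp a 2)
    (G : Lp ℂ 2 (volume : Measure ℝ)) :
    fourierMultiplierL2 (ha.toLp a) G =ᵐ[volume] multiplierFun a G := by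
  have h : ((ContinuousLinearMap.mul ℂ ℂ).holder 2 (ha.toLp a) (𝓕 G) :
      Lp ℂ 2 (volume : Measure ℝ)) =ᵐ[volume]
      fun ξ => a ξ * (𝓕 G : Lp ℂ 2 (volume : Measure ℝ)) ξ := by
    filter_upwards [(ContinuousLinearMap.mul ℂ ℂ).coeFn_holder (r := 2) (ha.toLp a) (𝓕 G),
      ha.coeFn_toLp] with ξ h1 h2
    rw [h1, h2]; rfl
  rw [fourierMultiplierL2_apply]
  refine (coeFn_fourierInv_of_integrable _ ((integrable_mul_fourier ha₂ G).congr h.symm)).trans ?_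
  exact Filter.Eventually.of_forall fun x => fourierInv_congr_ae h x

/-- Cauchy–Schwarz on the frequency side and Plancherel; this is the sup bound of the Sobolev
embedding. -/
theorem norm_multiplierFun_le {a : ℝ → ℂ} (ha : MemLp a 2)
    (G : Lp ℂ 2 (volume : Measure ℝ)) (x : ℝ) :
    ‖multiplierFun a G x‖ ≤ ‖ha.toLp a‖ * ‖G‖ := by
  have h1 : ‖multiplierFun a G x‖ ≤
      ∫ ξ, ‖a ξ * (𝓕 G : Lp ℂ 2 (volume : Measure ℝ)) ξ‖ := by
    rw [multiplierFun, fourierInv_eq]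
    refine (norm_integral_le_integral_norm _).trans (le_of_eq ?_)
    simp_rw [Circle.norm_smul]
  refine h1.trans ?_
  have h2 := (ContinuousLinearMap.mul ℂ ℂ).norm_holder_apply_apply_le (r := 1) (ha.toLp a) (𝓕 G)
  rw [L1.norm_eq_integral_norm, Lp.norm_fourier_eq] at h2
  have h3 : ∫ ξ, ‖a ξ * (𝓕 G : Lp ℂ 2 (volume : Measure ℝ)) ξ‖ =
      ∫ ξ, ‖(ContinuousLinearMap.mul ℂ ℂ).holder 1 (ha.toLp a) (𝓕 G) ξ‖ := by
    refine integral_congr_ae ?_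
    filter_upwards [(ContinuousLinearMap.mul ℂ ℂ).coeFn_holder (r := 1) (ha.toLp a) (𝓕 G),
      ha.coeFn_toLp] with ξ h1 h2
    rw [h1, h2]; rfl
  rw [h3]
  refine h2.trans ?_
  have : ‖ContinuousLinearMap.mul ℂ ℂ‖ ≤ 1 := ContinuousLinearMap.opNorm_mul_le _ _
  calc _ ≤ 1 * ‖ha.toLp a‖ * ‖G‖ := by gcongr
    _ = _ := by ring

/-! ### Bessel symbols and the Sobolev embedding -/

/-- The symbol of the operator `∂ʲ ⟨D⟩^(-σ)`. -/
def symbol (σ : ℝ) (j : ℕ) (ξ : ℝ) : ℂ :=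
  (2 * π * Complex.I * ξ) ^ j * ((1 + ‖ξ‖ ^ 2) ^ (-σ / 2) : ℝ)

theorem continuous_symbol (σ : ℝ) (j : ℕ) : Continuous (symbol σ j) := by
  have : Continuous fun ξ : ℝ => (1 + ‖ξ‖ ^ 2) ^ (-σ / 2) :=
    Continuous.rpow_const (by fun_prop) fun x => Or.inl (by positivity)
  unfold symbol
  fun_prop

/-- Each derivative costs one power of `⟨ξ⟩`. The symbol is thus bounded for `j ≤ σ` and, in one
dimension, square integrable for `σ - j > 1/2`. -/
theorem norm_symbol_le (σ : ℝ) (j : ℕ) (ξ : ℝ) :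
    ‖symbol σ j ξ‖ ≤ (2 * π) ^ j * (1 + ‖ξ‖ ^ 2) ^ (-(σ - j) / 2) := by
  have h0 : ‖ξ‖ ^ j ≤ (1 + ‖ξ‖ ^ 2) ^ ((j : ℝ) / 2) := by
    have : ‖ξ‖ ^ j = (‖ξ‖ ^ 2) ^ ((j : ℝ) / 2) := by
      rw [← Real.rpow_natCast, ← Real.rpow_natCast, ← Real.rpow_mul (norm_nonneg _)]
      congr 1; push_cast; ring
    rw [this]
    exact Real.rpow_le_rpow (by positivity) (by linarith) (by positivity)
  have h1 : ‖symbol σ j ξ‖ = (2 * π) ^ j * ‖ξ‖ ^ j * (1 + ‖ξ‖ ^ 2) ^ (-σ / 2) := by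
    rw [symbol, norm_mul, norm_pow, norm_mul, norm_mul, norm_mul, Complex.norm_real,
      Complex.norm_real, Complex.norm_real, Complex.norm_I, mul_one,
      Real.norm_of_nonneg (show (0 : ℝ) ≤ (1 + ‖ξ‖ ^ 2) ^ (-σ / 2) by positivity), mul_pow,
      Real.norm_of_nonneg Real.pi_pos.le]
    simp
  rw [h1, mul_assoc]
  gcongr
  calc _ ≤ (1 + ‖ξ‖ ^ 2) ^ ((j : ℝ) / 2) * (1 + ‖ξ‖ ^ 2) ^ (-σ / 2) := by gcongr
    _ = _ := by rw [← Real.rpow_add (by positivity)]; congr 1; ring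

theorem memLp_top_symbol {σ : ℝ} {j : ℕ} (h : (j : ℝ) ≤ σ) : MemLp (symbol σ j) ⊤ volume := by
  refine memLp_top_of_bound (continuous_symbol σ j).aestronglyMeasurable ((2 * π) ^ j)
    (Filter.Eventually.of_forall fun ξ => (norm_symbol_le σ j ξ).trans ?_)
  refine mul_le_of_le_one_right (by positivity) ?_
  exact Real.rpow_le_one_of_one_le_of_nonpos (by simp [sq_nonneg]) (by linarith)

theorem memLp_two_symbol {σ : ℝ} {j : ℕ} (h : (j : ℝ) + 1 / 2 < σ) :
    MemLp (symbol σ j) 2 volume := by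
  rw [memLp_two_iff_integrable_sq_norm (continuous_symbol σ j).aestronglyMeasurable]
  have h1 : Integrable fun ξ : ℝ => (1 + ‖ξ‖ ^ 2) ^ (-(2 * (σ - j)) / 2) :=
    integrable_rpow_neg_one_add_norm_sq (by simp; linarith)
  refine (h1.const_mul (((2 * π) ^ j) ^ 2)).mono'
    ((continuous_symbol σ j).norm.pow 2).aestronglyMeasurable
    (Filter.Eventually.of_forall fun ξ => ?_)
  rw [norm_pow, norm_norm]
  calc _ ≤ ((2 * π) ^ j * (1 + ‖ξ‖ ^ 2) ^ (-(σ - j) / 2)) ^ 2 := by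
        gcongr; exact norm_symbol_le σ j ξ
    _ = _ := by
        rw [mul_pow, ← Real.rpow_mul_natCast (by positivity)]
        congr 2; push_cast; ring

/-- The threshold `3/2` puts the symbol of order `j + 1` in `L²`, which allows differentiation under
the Fourier integral. -/
theorem hasDerivAt_multiplierFun_symbol {σ : ℝ} {j : ℕ} (h : (j : ℝ) + 3 / 2 < σ)
    (G : Lp ℂ 2 (volume : Measure ℝ)) (x : ℝ) :
    HasDerivAt (multiplierFun (symbol σ j) G) (multiplierFun (symbol σ (j + 1)) G x) x := by
  have h1 := integrable_mul_fourier (memLp_two_symbol (σ := σ) (j := j) (by linarith)) G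
  have h2 := integrable_mul_fourier
    (memLp_two_symbol (σ := σ) (j := j + 1) (by push_cast; linarith)) G
  have e : (fun ξ : ℝ => symbol σ (j + 1) ξ * (𝓕 G : Lp ℂ 2 (volume : Measure ℝ)) ξ) =
      fun ξ : ℝ => (2 * π * Complex.I * ξ) *
        (symbol σ j ξ * (𝓕 G : Lp ℂ 2 (volume : Measure ℝ)) ξ) := by
    ext ξ
    simp only [symbol, pow_succ]
    ring
  rw [multiplierFun, multiplierFun, e]
  rw [e] at h2
  exact hasDerivAt_fourierInv h1 h2 x

theorem toTemperedDistribution_injective {f g : Lp ℂ 2 (volume : Measure ℝ)}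
    (h : (f : 𝓢'(ℝ, ℂ)) = g) : f = g :=
  LinearMap.ker_eq_bot.1 (Lp.ker_toTemperedDistributionCLM_eq_bot (F := ℂ) (p := 2)
    (μ := (volume : Measure ℝ))) h

/-- The Bessel potential of order `σ` is inverted by the multiplier with symbol `⟨ξ⟩^(-σ)`. -/
theorem eq_fourierMultiplierL2_of_besselPotential_eq {σ : ℝ} (hσ : 0 ≤ σ)
    {f F : Lp ℂ 2 (volume : Measure ℝ)}
    (h : besselPotential ℝ ℂ σ (f : 𝓢'(ℝ, ℂ)) = (F : 𝓢'(ℝ, ℂ))) :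
    f = fourierMultiplierL2 ((memLp_top_symbol (σ := σ) (j := 0) (by simpa)).toLp _) F := by
  apply toTemperedDistribution_injective
  have h0 : besselPotential ℝ ℂ (-σ) (F : 𝓢'(ℝ, ℂ)) = (f : 𝓢'(ℝ, ℂ)) :=
    (besselPotential_neg_apply_eq_iff σ _ _).2 h
  have hs : symbol σ 0 = fun ξ : ℝ => (((1 + ‖ξ‖ ^ 2) ^ (-σ / 2) : ℝ) : ℂ) := by
    ext ξ; simp [symbol]
  have hg : (symbol σ 0).HasTemperateGrowth := by
    rw [hs]; fun_prop
  rw [← h0, besselPotential, TemperedDistribution.fourierMultiplierCLM_apply,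
    Lp.fourier_toTemperedDistribution_eq, ← hs,
    ← Lp.toTemperedDistribution_smul_eq (p := ⊤) (r := 2) hg
      (memLp_top_symbol (σ := σ) (j := 0) (by simpa)), Lp.fourierInv_toTemperedDistribution_eq]
  rfl

/-- The real part of `∂ʲ ⟨D⟩^(-σ) G`, as a function. -/
def sobolevFun (σ : ℝ) (j : ℕ) (G : Lp ℂ 2 (volume : Measure ℝ)) (x : ℝ) : ℝ :=
  (multiplierFun (symbol σ j) G x).re

/-- The real part of `∂ʲ ⟨D⟩^(-σ) G`, as an element of `L²`. -/
def sobolevL2 (σ : ℝ) (j : ℕ) (h : (j : ℝ) ≤ σ) :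
    Lp ℂ 2 (volume : Measure ℝ) →L[ℝ] Lp ℝ 2 (volume : Measure ℝ) :=
  (Complex.reCLM.compLpL 2 volume) ∘L
    (fourierMultiplierL2 ((memLp_top_symbol h).toLp _)).restrictScalars ℝ

theorem coeFn_sobolevL2 {σ : ℝ} {j : ℕ} (h : (j : ℝ) ≤ σ) (h' : (j : ℝ) + 1 / 2 < σ)
    (G : Lp ℂ 2 (volume : Measure ℝ)) :
    sobolevL2 σ j h G =ᵐ[volume] sobolevFun σ j G := by
  filter_upwards [Complex.reCLM.coeFn_compLpL (p := 2) (μ := volume)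
    (fourierMultiplierL2 ((memLp_top_symbol h).toLp _) G),
    coeFn_fourierMultiplierL2 (memLp_top_symbol h) (memLp_two_symbol h') G] with x h1 h2
  change Complex.reCLM.compLpL 2 volume
    (fourierMultiplierL2 ((memLp_top_symbol h).toLp _) G) x = _
  rw [h1, h2]; rfl

theorem memLp_sobolevFun {σ : ℝ} {j : ℕ} (h : (j : ℝ) + 1 / 2 < σ)
    (G : Lp ℂ 2 (volume : Measure ℝ)) : MemLp (sobolevFun σ j G) 2 volume :=
  (memLp_congr_ae (coeFn_sobolevL2 (by linarith) h G)).1 (Lp.memLp _)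

theorem continuous_sobolevFun {σ : ℝ} {j : ℕ} (h : (j : ℝ) + 1 / 2 < σ)
    (G : Lp ℂ 2 (volume : Measure ℝ)) : Continuous (sobolevFun σ j G) :=
  Complex.continuous_re.comp (continuous_multiplierFun (memLp_two_symbol h) G)

theorem exists_abs_sobolevFun_le {σ : ℝ} {j : ℕ} (h : (j : ℝ) + 1 / 2 < σ) :
    ∃ C : ℝ, 0 ≤ C ∧ ∀ (G : Lp ℂ 2 (volume : Measure ℝ)) (x : ℝ),
      |sobolevFun σ j G x| ≤ C * ‖G‖ :=
  ⟨_, norm_nonneg _, fun G x =>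
    (Complex.abs_re_le_norm _).trans (norm_multiplierFun_le (memLp_two_symbol h) G x)⟩

theorem hasDerivAt_sobolevFun {σ : ℝ} {j : ℕ} (h : (j : ℝ) + 3 / 2 < σ)
    (G : Lp ℂ 2 (volume : Measure ℝ)) (x : ℝ) :
    HasDerivAt (sobolevFun σ j G) (sobolevFun σ (j + 1) G x) x :=
  Complex.reCLM.hasFDerivAt.comp_hasDerivAt x (hasDerivAt_multiplierFun_symbol h G x)

/-- Inverting the Bessel potential gives equality almost everywhere; continuity of both sides makes
it hold everywhere. -/
theorem eq_sobolevFun {σ : ℝ} (hσ : 1 / 2 < σ) {f : ℝ → ℝ} (hf : Continuous f)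
    (h : MemLp (fun x : ℝ => (f x : ℂ)) 2 volume) {F : Lp ℂ 2 (volume : Measure ℝ)}
    (hF : besselPotential ℝ ℂ σ (h.toLp (fun x : ℝ => (f x : ℂ)) : 𝓢'(ℝ, ℂ)) = (F : 𝓢'(ℝ, ℂ))) :
    f = sobolevFun σ 0 F := by
  have h1 := eq_fourierMultiplierL2_of_besselPotential_eq (by linarith) hF
  have h2 := coeFn_fourierMultiplierL2 (memLp_top_symbol (σ := σ) (j := 0) (by simp; linarith))
    (memLp_two_symbol (by simpa using hσ)) F
  rw [← h1] at h2
  refine Continuous.ae_eq_iff_eq volume hf (continuous_sobolevFun (by simpa using hσ) F) |>.1 ?_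
  filter_upwards [h.coeFn_toLp, h2] with x h3 h4
  rw [sobolevFun, ← h4, h3, Complex.ofReal_re]

/-! ### Weak derivatives and the orthogonality relation -/

theorem integrable_mul_of_hasCompactSupport {f g : ℝ → ℝ} (hf : Continuous f)
    (hg : Continuous g) (hgc : HasCompactSupport g) : Integrable fun x => f x * g x :=
  (hf.mul hg).integrable_of_hasCompactSupport hgc.mul_left

/-- A test function of zero mean is the derivative of a test function. -/
theorem exists_testFunction_deriv_eq {θ : ℝ → ℝ} (hθ : ContDiff ℝ ∞ θ)
    (hθc : HasCompactSupport θ) (hθ0 : ∫ x, θ x = 0) :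
    ∃ φ : ℝ → ℝ, ContDiff ℝ ∞ φ ∧ HasCompactSupport φ ∧ deriv φ = θ := by
  obtain ⟨R, hR⟩ := hθc.isCompact.isBounded.subset_closedBall (0 : ℝ)
  have hzero : ∀ x, x ∉ Set.Icc (-R) R → θ x = 0 := fun x hx => by
    by_contra hne
    have := hR (subset_tsupport θ hne)
    rw [Real.closedBall_eq_Icc] at this
    exact hx (by simpa using this)
  have hint : Integrable θ := hθ.continuous.integrable_of_hasCompactSupport hθc
  have hder : ∀ x, HasDerivAt (fun x => ∫ y in Set.Iic x, θ y) (θ x) x := fun x => by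
    have h1 : (fun x => ∫ y in Set.Iic x, θ y) =
        fun x => (∫ y in Set.Iic 0, θ y) + ∫ y in (0 : ℝ)..x, θ y := by
      ext x
      rw [← intervalIntegral.integral_Iic_sub_Iic hint.integrableOn hint.integrableOn]
      ring
    rw [h1]
    exact (intervalIntegral.integral_hasDerivAt_right hint.intervalIntegrable
      hθ.continuous.stronglyMeasurable.stronglyMeasurableAtFilter
      hθ.continuous.continuousAt).const_add _
  have hd : deriv (fun x => ∫ y in Set.Iic x, θ y) = θ := funext fun x => (hder x).deriv
  refine ⟨fun x => ∫ y in Set.Iic x, θ y, ?_, ?_, hd⟩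
  · rw [contDiff_infty_iff_deriv]
    exact ⟨fun x => (hder x).differentiableAt, by rwa [hd]⟩
  · refine HasCompactSupport.intro (isCompact_Icc (a := -R) (b := R)) fun x hx => ?_
    rw [Set.mem_Icc, not_and_or, not_le, not_le] at hx
    rcases hx with hx | hx
    · refine setIntegral_eq_zero_of_forall_eq_zero fun y hy => hzero y fun h => ?_
      have := h.1.trans hy
      linarith
    · rw [← hθ0]
      refine setIntegral_eq_integral_of_forall_compl_eq_zero fun y hy => hzero y fun h => ?_
      exact hy (h.2.trans hx.le)

/-- The du Bois-Reymond lemma. -/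
theorem exists_eq_const_of_integral_mul_deriv_eq_zero {f : ℝ → ℝ} (hf : Continuous f)
    (h : ∀ φ : ℝ → ℝ, ContDiff ℝ ∞ φ → HasCompactSupport φ → ∫ x, f x * deriv φ x = 0) :
    ∃ c, ∀ x, f x = c := by
  let ρ : ContDiffBump (0 : ℝ) := ⟨1, 2, one_pos, one_lt_two⟩
  let r : ℝ → ℝ := ρ.normed volume
  have hr : ContDiff ℝ ∞ r := ρ.contDiff_normed
  have hrc : HasCompactSupport r := ρ.hasCompactSupport_normed
  have hr1 : ∫ x, r x = 1 := ρ.integral_normed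
  have hint : ∀ g : ℝ → ℝ, ContDiff ℝ ∞ g → HasCompactSupport g → Integrable g :=
    fun g hg hgc => hg.continuous.integrable_of_hasCompactSupport hgc
  have hintf : ∀ g : ℝ → ℝ, ContDiff ℝ ∞ g → HasCompactSupport g → Integrable fun x => f x * g x :=
    fun g hg hgc => integrable_mul_of_hasCompactSupport hf hg.continuous hgc
  refine ⟨∫ x, f x * r x, fun x => congrFun (g := fun _ => ∫ x, f x * r x) ?_ x⟩
  refine Continuous.ae_eq_iff_eq volume hf continuous_const |>.1 ?_
  refine ae_eq_of_integral_contDiff_smul_eq hf.locallyIntegrable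
    continuous_const.locallyIntegrable fun ψ hψ hψc => ?_
  -- Subtracting a multiple of the unit-mass bump gives zero mean, so `θ` is an admissible
  -- derivative.
  let θ : ℝ → ℝ := fun x => ψ x - (∫ y, ψ y) * r x
  have hθ : ContDiff ℝ ∞ θ := hψ.sub (contDiff_const.mul hr)
  have hθc : HasCompactSupport θ := hψc.sub hrc.mul_left
  have hθ0 : ∫ x, θ x = 0 := by
    simp only [θ]
    rw [integral_sub (hint ψ hψ hψc) ((hint r hr hrc).const_mul _), integral_const_mul, hr1]
    ring
  obtain ⟨φ, hφ, hφc, hφd⟩ := exists_testFunction_deriv_eq hθ hθc hθ0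
  have h1 := h φ hφ hφc
  rw [hφd] at h1
  have h2 : ∫ x, f x * θ x = (∫ x, f x * ψ x) - (∫ y, ψ y) * ∫ x, f x * r x := by
    rw [← integral_const_mul, ← integral_sub (hintf ψ hψ hψc) ((hintf r hr hrc).const_mul _)]
    congr 1; ext x; simp only [θ]; ring
  simp only [smul_eq_mul]
  rw [integral_mul_const]
  simp_rw [mul_comm (ψ _)]
  linarith

theorem integral_mul_deriv_testFunction {W v : ℝ → ℝ} (hW : ∀ x, HasDerivAt W (v x) x)
    (hv : Continuous v) {φ : ℝ → ℝ} (hφ : ContDiff ℝ ∞ φ) (hφc : HasCompactSupport φ) :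
    ∫ x, W x * deriv φ x = -∫ x, v x * φ x := by
  have hWc : Continuous W := continuous_iff_continuousAt.2 fun x => (hW x).continuousAt
  have hd : Continuous (deriv φ) := hφ.continuous_deriv (by simp)
  exact integral_mul_deriv_eq_deriv_mul_of_integrable (fun x _ => hW x)
    (fun x _ => (hφ.differentiable (by simp) x).hasDerivAt)
    (integrable_mul_of_hasCompactSupport hWc hd hφc.deriv)
    (integrable_mul_of_hasCompactSupport hv hφ.continuous hφc)
    (integrable_mul_of_hasCompactSupport hWc hφ.continuous hφc)

/-- A continuous function with continuous weak derivative is differentiable. -/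
theorem hasDerivAt_of_weak_deriv {v w : ℝ → ℝ} (hv : Continuous v) (hw : Continuous w)
    (h : ∀ φ : ℝ → ℝ, ContDiff ℝ ∞ φ → HasCompactSupport φ →
      ∫ x, w x * deriv φ x = -∫ x, v x * φ x) (x : ℝ) :
    HasDerivAt w (v x) x := by
  let W : ℝ → ℝ := fun x => ∫ y in (0 : ℝ)..x, v y
  have hW : ∀ x, HasDerivAt W (v x) x := fun x =>
    intervalIntegral.integral_hasDerivAt_right (hv.intervalIntegrable _ _)
      hv.stronglyMeasurable.stronglyMeasurableAtFilter hv.continuousAt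
  have hWc : Continuous W := continuous_iff_continuousAt.2 fun x => (hW x).continuousAt
  obtain ⟨c, hc⟩ := exists_eq_const_of_integral_mul_deriv_eq_zero (hw.sub hWc)
    fun φ hφ hφc => by
      have hd : Continuous (deriv φ) := hφ.continuous_deriv (by simp)
      simp only [Pi.sub_apply, sub_mul]
      rw [integral_sub (integrable_mul_of_hasCompactSupport hw hd hφc.deriv)
        (integrable_mul_of_hasCompactSupport hWc hd hφc.deriv), h φ hφ hφc,
        integral_mul_deriv_testFunction hW hv hφ hφc, sub_self]
  have : w = fun x => W x + c := by
    ext x; have := hc x; simp only [Pi.sub_apply] at this; linarith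
  rw [this]
  exact (hW x).add_const c

/-- If `v - v'' = -c E'` weakly, then `E` is orthogonal to `v`. -/
theorem integral_mul_eq_zero_of_weak_eq {v v' E : ℝ → ℝ} {c : ℝ} (hc : c ≠ 0)
    (hv : ∀ x, HasDerivAt v (v' x) x) (hv' : Continuous v') (hE : Continuous E)
    (hv2 : MemLp v 2 volume) (hv'2 : MemLp v' 2 volume) (hE2 : MemLp E 2 volume)
    (h : ∀ φ : ℝ → ℝ, ContDiff ℝ ∞ φ → HasCompactSupport φ →
      (∫ x, v x * φ x) + (∫ x, v' x * deriv φ x) = c * ∫ x, E x * deriv φ x) :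
    ∫ x, E x * v x = 0 := by
  have hvc : Continuous v := continuous_iff_continuousAt.2 fun x => (hv x).continuousAt
  -- `v'` alone need not be differentiable, but `v' - cE` has the continuous weak derivative `v`.
  let w : ℝ → ℝ := fun x => v' x - c * E x
  have hw2 : MemLp w 2 volume := hv'2.sub (hE2.const_mul c)
  have hw : ∀ x, HasDerivAt w (v x) x := by
    refine hasDerivAt_of_weak_deriv hvc (hv'.sub (continuous_const.mul hE)) fun φ hφ hφc => ?_
    have hd : Continuous (deriv φ) := hφ.continuous_deriv (by simp)
    have h1 : ∫ x, w x * deriv φ x =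
        (∫ x, v' x * deriv φ x) - c * ∫ x, E x * deriv φ x := by
      rw [← integral_const_mul, ← integral_sub
        (integrable_mul_of_hasCompactSupport hv' hd hφc.deriv)
        ((integrable_mul_of_hasCompactSupport hE hd hφc.deriv).const_mul c)]
      congr 1; ext x; simp only [w]; ring
    rw [h1, ← h φ hφ hφc]; ring
  have hvv' : Integrable fun x => v' x * v x := hv'2.integrable_mul hv2
  have hwv : Integrable fun x => w x * v x := hw2.integrable_mul hv2
  have hvv : Integrable fun x => v x * v x := hv2.integrable_mul hv2
  have hww : Integrable fun x => w x * w x := hw2.integrable_mul hw2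
  have h1 : ∫ x, v' x * v x + v x * v' x = 0 :=
    integral_eq_zero_of_hasDerivAt_of_integrable (fun x => (hv x).mul (hv x))
      (hvv'.add (by simpa only [mul_comm] using hvv')) hvv
  have h2 : ∫ x, v x * w x + w x * v x = 0 :=
    integral_eq_zero_of_hasDerivAt_of_integrable (fun x => (hw x).mul (hw x))
      ((by simpa only [mul_comm] using hwv : Integrable fun x => v x * w x).add hwv) hww
  -- `E v` is the derivative of `(v² - w²)/(2c)`.
  have h3 : ∀ x, E x * v x = (2 * c)⁻¹ * ((v' x * v x + v x * v' x) - (v x * w x + w x * v x)) := by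
    intro x; simp only [w]; field_simp; ring
  simp_rw [h3]
  rw [integral_const_mul, integral_sub, h1, h2]
  · simp
  · exact hvv'.add (by simpa only [mul_comm] using hvv')
  · exact (by simpa only [mul_comm] using hwv : Integrable fun x => v x * w x).add hwv

/-! ### Uniform Taylor estimate -/

/-- Taylor's estimate of order two, uniform on balls. -/
theorem exists_taylor_bound {f : ℝ × ℝ → ℝ} (hf : ContDiff ℝ 2 f) (R : ℝ) :
    ∃ C : ℝ, 0 ≤ C ∧ ∀ x ∈ Metric.closedBall (0 : ℝ × ℝ) R, ∀ y ∈ Metric.closedBall (0 : ℝ × ℝ) R,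
      ‖fderiv ℝ f y - fderiv ℝ f x‖ ≤ C * ‖y - x‖ ∧
      |f y - f x - fderiv ℝ f x (y - x)| ≤ C * ‖y - x‖ ^ 2 := by
  have hf1 : ContDiff ℝ 1 (fderiv ℝ f) := hf.fderiv_right (by norm_num)
  have hcont : Continuous fun x => ‖fderiv ℝ (fderiv ℝ f) x‖ :=
    (hf1.continuous_fderiv (by norm_num)).norm
  obtain ⟨C, hC⟩ := (isCompact_closedBall (0 : ℝ × ℝ) R).bddAbove_image hcont.continuousOn
  have hC' : ∀ x ∈ Metric.closedBall (0 : ℝ × ℝ) R, ‖fderiv ℝ (fderiv ℝ f) x‖ ≤ max C 0 :=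
    fun x hx => (hC (Set.mem_image_of_mem _ hx)).trans (le_max_left _ _)
  have hlip : ∀ x ∈ Metric.closedBall (0 : ℝ × ℝ) R, ∀ y ∈ Metric.closedBall (0 : ℝ × ℝ) R,
      ‖fderiv ℝ f y - fderiv ℝ f x‖ ≤ max C 0 * ‖y - x‖ := fun x hx y hy =>
    (convex_closedBall (0 : ℝ × ℝ) R).norm_image_sub_le_of_norm_fderiv_le
      (fun z _ => hf1.differentiable (by norm_num) z) hC' hx hy
  refine ⟨max C 0, le_max_right _ _, fun x hx y hy => ⟨hlip x hx y hy, ?_⟩⟩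
  have hseg : segment ℝ x y ⊆ Metric.closedBall (0 : ℝ × ℝ) R :=
    (convex_closedBall (0 : ℝ × ℝ) R).segment_subset hx hy
  have := (convex_segment x y).norm_image_sub_le_of_norm_hasFDerivWithin_le'
    (f := f) (f' := fderiv ℝ f) (φ := fderiv ℝ f x) (C := max C 0 * ‖y - x‖)
    (fun z _ => (hf.differentiable (by norm_num) z).hasFDerivAt.hasFDerivWithinAt)
    (fun z hz => (hlip x hx z (hseg hz)).trans ?_)
    (left_mem_segment ℝ x y) (right_mem_segment ℝ x y)
  · rw [Real.norm_eq_abs] at this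
    refine this.trans (le_of_eq (by ring))
  · gcongr
    exact norm_sub_le_of_mem_segment hz

/-! ### Algebra of the density -/

/-- The coefficients of the density of `H₂`. -/
def coeff (n k : ℕ) : ℝ := (-1 : ℝ) ^ (k + 1) / (2 * (k : ℝ) - 1) * (n.choose k : ℝ)

/-- The operator `b ∂_b - 1` multiplies the `k`-th monomial by `2k - 1`; cancelling the denominator
leaves binomial coefficients, whence `P - b P_b = a (a² - b²)ⁿ`. -/
theorem coeff_mul (n k : ℕ) : coeff n k * (2 * k - 1) = (-1) ^ (k + 1) * n.choose k := by
  have : (2 * (k : ℝ) - 1) ≠ 0 := by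
    intro h
    have h2 : (2 * k : ℝ) = 1 := by linarith
    have h3 : 2 * k = 1 := by exact_mod_cast h2
    omega
  unfold coeff
  field_simp

/-- The density of `H₂` as a polynomial in `(u, u_x)`. -/
def densityPoly (n : ℕ) (z : ℝ × ℝ) : ℝ :=
  ∑ k ∈ Finset.range (n + 1), coeff n k * z.1 ^ (2 * n - 2 * k + 1) * z.2 ^ (2 * k)

/-- The derivative of `densityPoly` in the first variable. -/
def densityPolyFst (n : ℕ) (a b : ℝ) : ℝ :=
  ∑ k ∈ Finset.range (n + 1),
    coeff n k * ((2 * n - 2 * k + 1 : ℕ) * a ^ (2 * n - 2 * k)) * b ^ (2 * k)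

/-- The derivative of `densityPoly` in the second variable. -/
def densityPolySnd (n : ℕ) (a b : ℝ) : ℝ :=
  ∑ k ∈ Finset.range (n + 1),
    coeff n k * a ^ (2 * n - 2 * k + 1) * ((2 * k : ℕ) * b ^ (2 * k - 1))

/-- `coeff n 0 = (-1)/(-1) = 1`, so `u^(2n+1)` is the term `k = 0`. -/
theorem H2density_eq (n : ℕ) (f : ℝ → ℝ) (x : ℝ) :
    H2density n f x = densityPoly n (f x, deriv f x) := by
  have h : Finset.range (n + 1) = insert 0 (Finset.Icc 1 n) := by
    ext k; simp; omega
  rw [densityPoly, h, Finset.sum_insert (by simp)]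
  simp [H2density, coeff]

theorem contDiff_densityPoly (n : ℕ) : ContDiff ℝ 2 (densityPoly n) := by
  unfold densityPoly
  fun_prop

theorem fderiv_densityPoly (n : ℕ) (a b x y : ℝ) :
    fderiv ℝ (densityPoly n) (a, b) (x, y) =
      densityPolyFst n a b * x + densityPolySnd n a b * y := by
  have h1 : HasFDerivAt (fun z : ℝ × ℝ => z.1) (ContinuousLinearMap.fst ℝ ℝ ℝ) (a, b) :=
    hasFDerivAt_fst
  have h2 : HasFDerivAt (fun z : ℝ × ℝ => z.2) (ContinuousLinearMap.snd ℝ ℝ ℝ) (a, b) :=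
    hasFDerivAt_snd
  have h := HasFDerivAt.fun_sum (u := Finset.range (n + 1)) fun k _ =>
    ((h1.pow (2 * n - 2 * k + 1)).const_mul (coeff n k)).mul (h2.pow (2 * k))
  have h' : fderiv ℝ (densityPoly n) (a, b) = _ := h.fderiv
  rw [h', densityPolyFst, densityPolySnd, Finset.sum_mul, Finset.sum_mul,
    ← Finset.sum_add_distrib]
  simp only [_root_.sum_apply, _root_.add_apply,
    _root_.smul_apply, ContinuousLinearMap.coe_fst', ContinuousLinearMap.coe_snd',
    smul_eq_mul, Nat.add_sub_cancel, nsmul_eq_mul]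
  refine Finset.sum_congr rfl fun k _ => ?_
  ring

theorem sub_sq_pow_eq_sum (m : ℕ) (a b : ℝ) :
    (a ^ 2 - b ^ 2) ^ m =
      ∑ k ∈ Finset.range (m + 1),
        (-1) ^ k * (m.choose k : ℝ) * a ^ (2 * m - 2 * k) * b ^ (2 * k) := by
  rw [sub_eq_neg_add, add_pow]
  refine Finset.sum_congr rfl fun k _ => ?_
  rw [← Nat.mul_sub, pow_mul a, pow_mul b, neg_pow]
  ring

/-- Both sides are `∂_a [a (a² - b²)^(m+1)]`; the factor `2(m+1) - 2k` is absorbed into the binomial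
coefficient. -/
theorem sum_choose_mul_succ (m : ℕ) (a b : ℝ) :
    ∑ k ∈ Finset.range (m + 2), (-1) ^ k * ((m + 1).choose k : ℝ) *
      (2 * (m + 1) - 2 * k + 1 : ℕ) * a ^ (2 * (m + 1) - 2 * k) * b ^ (2 * k) =
    (a ^ 2 - b ^ 2) ^ (m + 1) + 2 * (m + 1) * a ^ 2 * (a ^ 2 - b ^ 2) ^ m := by
  have h : ∑ k ∈ Finset.range (m + 2), (-1) ^ k * ((m + 1).choose k : ℝ) *
      (2 * (m + 1) - 2 * k : ℕ) * a ^ (2 * (m + 1) - 2 * k) * b ^ (2 * k) =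
      2 * (m + 1) * a ^ 2 * (a ^ 2 - b ^ 2) ^ m := by
    rw [Finset.sum_range_succ, sub_sq_pow_eq_sum, Finset.mul_sum]
    simp only [Nat.sub_self, Nat.cast_zero, mul_zero, zero_mul, add_zero]
    refine Finset.sum_congr rfl fun k hk => ?_
    have hk' : k ≤ m := by simpa [Nat.lt_succ_iff] using hk
    have e1 : 2 * (m + 1) - 2 * k = 2 * m - 2 * k + 2 := by omega
    have e2 : ((2 * (m + 1) - 2 * k : ℕ) : ℝ) = 2 * (m + 1 - k : ℕ) := by
      rw [← Nat.mul_sub]; push_cast; ring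
    have e3 : ((m.choose k : ℝ)) * (m + 1) = (m + 1).choose k * (m + 1 - k : ℕ) := by
      exact_mod_cast Nat.choose_mul_succ_eq m k
    rw [e2, e1, pow_add]
    linear_combination (-2 * (-1) ^ k * a ^ (2 * m - 2 * k) * a ^ 2 * b ^ (2 * k)) * e3
  rw [← h, sub_sq_pow_eq_sum, ← Finset.sum_add_distrib]
  refine Finset.sum_congr rfl fun k _ => ?_
  push_cast
  ring

/-- This computes `P_bb` for `n = m + 1`: the factor `2k - 1` cancels the denominator and `2k` is
absorbed into the binomial coefficient. -/
theorem sum_coeff_snd_snd (m : ℕ) (a b : ℝ) :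
    ∑ k ∈ Finset.range (m + 2), coeff (m + 1) k * a ^ (2 * (m + 1) - 2 * k + 1) *
      ((2 * k : ℕ) * ((2 * k - 1 : ℕ) * b ^ (2 * k - 1 - 1))) =
    2 * (m + 1) * a * (a ^ 2 - b ^ 2) ^ m := by
  rw [Finset.sum_range_succ', sub_sq_pow_eq_sum, Finset.mul_sum]
  simp only [mul_zero, Nat.cast_zero, zero_mul, add_zero]
  refine Finset.sum_congr rfl fun k _ => ?_
  have e1 : 2 * (m + 1) - 2 * (k + 1) + 1 = 2 * m - 2 * k + 1 := by omega
  have e2 : 2 * (k + 1) - 1 = 2 * k + 1 := by omega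
  have e3 : ((m + 1 : ℝ)) * m.choose k = (m + 1).choose (k + 1) * (k + 1) := by
    exact_mod_cast Nat.add_one_mul_choose_eq m k
  have e4 := coeff_mul (m + 1) (k + 1)
  rw [e1, e2, Nat.add_sub_cancel, pow_succ]
  push_cast at e4 ⊢
  rw [show (-1 : ℝ) ^ (k + 1 + 1) = (-1) ^ k by ring] at e4
  linear_combination (a ^ (2 * m - 2 * k) * a * (2 * (k + 1)) * b ^ (2 * k)) * e4 -
    (2 * (-1) ^ k * a ^ (2 * m - 2 * k) * a * b ^ (2 * k)) * e3

/-- The derivative of `densityPolySnd n (u, u_x)` along a function, expressed through the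
variational derivative of `H₂`. -/
theorem hasDerivAt_densityPolySnd {n : ℕ} (hn : 1 ≤ n) {u p q : ℝ → ℝ} {x : ℝ}
    (hu : HasDerivAt u (p x) x) (hp : HasDerivAt p (q x) x) :
    HasDerivAt (fun x => densityPolySnd n (u x) (p x))
      (densityPolyFst n (u x) (p x) - ((u x ^ 2 - p x ^ 2) ^ n +
        2 * n * ((u x ^ 2 - p x ^ 2) ^ (n - 1) * u x * (u x - q x)))) x := by
  obtain ⟨m, rfl⟩ : ∃ m, n = m + 1 := ⟨n - 1, by omega⟩
  have h := HasDerivAt.fun_sum (u := Finset.range (m + 1 + 1)) fun k _ =>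
    ((hu.pow (2 * (m + 1) - 2 * k + 1)).const_mul (coeff (m + 1) k)).mul
      ((hp.pow (2 * k - 1)).const_mul ((2 * k : ℕ) : ℝ))
  unfold densityPolySnd
  convert! h using 1
  have h1 := sum_choose_mul_succ m (u x) (p x)
  have h2 := sum_coeff_snd_snd m (u x) (p x)
  -- The `a`-derivative of `P - b P_b = a (a² - b²)ⁿ`: `P_a = b P_ab + ∂_a [a (a² - b²)ⁿ]`.
  have h3 : densityPolyFst (m + 1) (u x) (p x) =
      (∑ k ∈ Finset.range (m + 2), coeff (m + 1) k * ((2 * (m + 1) - 2 * k + 1 : ℕ) *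
        u x ^ (2 * (m + 1) - 2 * k)) * ((2 * k : ℕ) * p x ^ (2 * k - 1) * p x)) +
      ∑ k ∈ Finset.range (m + 2), (-1) ^ k * ((m + 1).choose k : ℝ) *
        (2 * (m + 1) - 2 * k + 1 : ℕ) * u x ^ (2 * (m + 1) - 2 * k) * p x ^ (2 * k) := by
    rw [densityPolyFst, ← Finset.sum_add_distrib]
    refine Finset.sum_congr rfl fun k _ => ?_
    have e : ((2 * k : ℕ) : ℝ) * p x ^ (2 * k - 1) * p x = 2 * k * p x ^ (2 * k) := by
      rcases k with _ | k
      · simp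
      · rw [show 2 * (k + 1) - 1 = 2 * k + 1 by omega, show 2 * (k + 1) = 2 * k + 1 + 1 by omega,
          pow_succ _ (2 * k + 1)]
        push_cast; ring
    have e4 := coeff_mul (m + 1) k
    rw [e]
    rw [pow_succ] at e4
    linear_combination (-((2 * (m + 1) - 2 * k + 1 : ℕ) : ℝ) *
        u x ^ (2 * (m + 1) - 2 * k) * p x ^ (2 * k)) * e4
  rw [h3, h1]
  have h4 : 2 * ((m + 1 : ℕ) : ℝ) * ((u x ^ 2 - p x ^ 2) ^ (m + 1 - 1) * u x * (u x - q x)) =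
      2 * (m + 1) * u x ^ 2 * (u x ^ 2 - p x ^ 2) ^ m -
        2 * (m + 1) * u x * (u x ^ 2 - p x ^ 2) ^ m * q x := by
    rw [Nat.add_sub_cancel]; push_cast; ring
  rw [h4, ← h2, Finset.sum_mul]
  -- What remains is the chain rule `∂_x P_b = P_ab u_x + P_bb u_xx`.
  rw [show ∀ A B C D : ℝ, A + (B + C) - (B + (C - D)) = A + D from fun A B C D => by ring,
    ← Finset.sum_add_distrib]
  refine Finset.sum_congr rfl fun k _ => ?_
  simp only [Nat.add_sub_cancel, Pi.pow_apply]
  ring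

/-! ### Differentiating integrals along `L²` curves -/

/-- The real parts of `⟨D⟩^(-σ) G` and of its derivative, as an `ℝ²`-valued `L²` function. -/
def sobolevPair (σ : ℝ) (h : 1 ≤ σ) :
    Lp ℂ 2 (volume : Measure ℝ) →L[ℝ] Lp (ℝ × ℝ) 2 (volume : Measure ℝ) :=
  (ContinuousLinearMap.inl ℝ ℝ ℝ).compLpL 2 volume ∘L sobolevL2 σ 0 (by simp; linarith) +
    (ContinuousLinearMap.inr ℝ ℝ ℝ).compLpL 2 volume ∘L sobolevL2 σ 1 (by simpa)

theorem coeFn_sobolevPair {σ : ℝ} (h : 1 ≤ σ) (h' : 3 / 2 < σ)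
    (G : Lp ℂ 2 (volume : Measure ℝ)) :
    sobolevPair σ h G =ᵐ[volume] fun x => (sobolevFun σ 0 G x, sobolevFun σ 1 G x) := by
  have h0 : ((0 : ℕ) : ℝ) ≤ σ := by simp; linarith
  have h1 : ((1 : ℕ) : ℝ) ≤ σ := by simpa
  filter_upwards [Lp.coeFn_add
      ((ContinuousLinearMap.inl ℝ ℝ ℝ).compLpL 2 volume (sobolevL2 σ 0 h0 G))
      ((ContinuousLinearMap.inr ℝ ℝ ℝ).compLpL 2 volume (sobolevL2 σ 1 h1 G)),
    (ContinuousLinearMap.inl ℝ ℝ ℝ).coeFn_compLpL (p := 2) (μ := volume) (sobolevL2 σ 0 h0 G),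
    (ContinuousLinearMap.inr ℝ ℝ ℝ).coeFn_compLpL (p := 2) (μ := volume) (sobolevL2 σ 1 h1 G),
    coeFn_sobolevL2 h0 (by simp; linarith) G,
    coeFn_sobolevL2 h1 (by push_cast; linarith) G] with x e e0 e1 e2 e3
  refine e.trans ?_
  rw [Pi.add_apply, e0, e1, e2, e3]
  simp

/-- Pairing with a fixed `L²` covector field is a bounded linear functional. It serves both the
tested equation and the linear part of `H₂`. -/
theorem hasDerivWithinAt_integral_apply {I : Set ℝ} {t : ℝ}
    {Z : ℝ → Lp (ℝ × ℝ) 2 (volume : Measure ℝ)} {Z' : Lp (ℝ × ℝ) 2 (volume : Measure ℝ)}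
    (hZ : HasDerivWithinAt Z Z' I t) {g : ℝ → (ℝ × ℝ) →L[ℝ] ℝ} (hg : MemLp g 2 volume) :
    HasDerivWithinAt (fun τ => ∫ x, g x (Z τ x)) (∫ x, g x (Z' x)) I t := by
  have h : ∀ Y : Lp (ℝ × ℝ) 2 (volume : Measure ℝ), ∫ x, g x (Y x) =
      (ContinuousLinearMap.id ℝ ((ℝ × ℝ) →L[ℝ] ℝ)).lpPairing volume 2 2 (hg.toLp g) Y := by
    intro Y
    rw [ContinuousLinearMap.lpPairing_eq_integral]
    refine integral_congr_ae ?_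
    filter_upwards [hg.coeFn_toLp] with x hx
    rw [hx]; rfl
  simp_rw [h]
  exact (ContinuousLinearMap.hasFDerivAt _).comp_hasDerivWithinAt t hZ

/-- The derivative of `P` vanishes at `0` and is Lipschitz on balls, so it is at most `C ‖z‖`;
likewise `|P z| ≤ C ‖z‖²` below. -/
theorem memLp_fderiv_comp {P : ℝ × ℝ → ℝ} (hP : ContDiff ℝ 2 P) (hP' : fderiv ℝ P 0 = 0)
    {R : ℝ} {z : ℝ → ℝ × ℝ} (hz : MemLp z 2 volume) (hR : ∀ᵐ x, ‖z x‖ ≤ R) :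
    MemLp (fun x => fderiv ℝ P (z x)) 2 volume := by
  -- The absolute value guarantees that the ball contains the origin.
  obtain ⟨C, -, hC⟩ := exists_taylor_bound hP |R|
  refine hz.of_le_mul (c := C)
    ((hP.continuous_fderiv (by norm_num)).comp_aestronglyMeasurable hz.1) ?_
  filter_upwards [hR] with x hx
  have := (hC 0 (by simp) (z x) (by simpa using hx.trans (le_abs_self R))).1
  simpa [hP'] using this

theorem integrable_comp {P : ℝ × ℝ → ℝ} (hP : ContDiff ℝ 2 P) (hP0 : P 0 = 0)
    (hP' : fderiv ℝ P 0 = 0) {R : ℝ} {z : ℝ → ℝ × ℝ} (hz : MemLp z 2 volume)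
    (hR : ∀ᵐ x, ‖z x‖ ≤ R) : Integrable fun x => P (z x) := by
  obtain ⟨C, -, hC⟩ := exists_taylor_bound hP |R|
  have h2 : Integrable fun x => ‖z x‖ ^ 2 := (memLp_two_iff_integrable_sq_norm hz.1).1 hz
  refine (h2.const_mul C).mono' (hP.continuous.comp_aestronglyMeasurable hz.1) ?_
  filter_upwards [hR] with x hx
  have := (hC 0 (by simp) (z x) (by simpa using hx.trans (le_abs_self R))).2
  simpa [hP', hP0] using this

theorem norm_sq_eq_integral (Y : Lp (ℝ × ℝ) 2 (volume : Measure ℝ)) :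
    ‖Y‖ ^ 2 = ∫ x, ‖Y x‖ ^ 2 := by
  rw [Lp.norm_def, toReal_eLpNorm (Lp.memLp Y).1,
    lpNorm_eq_integral_norm_rpow_toReal (by norm_num) (by norm_num) (Lp.memLp Y).1,
    ← Real.rpow_mul_natCast (integral_nonneg fun x => by positivity)]
  simp

/-- Under the uniform bound the integrated Taylor remainder is at most `C ‖Z τ - Z t‖² = O((τ -
t)²)`, so only the linearization contributes. -/
theorem hasDerivWithinAt_integral_comp {P : ℝ × ℝ → ℝ} (hP : ContDiff ℝ 2 P) (hP0 : P 0 = 0)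
    (hP' : fderiv ℝ P 0 = 0) {I : Set ℝ} {t : ℝ} (ht : t ∈ I)
    {Z : ℝ → Lp (ℝ × ℝ) 2 (volume : Measure ℝ)} {Z' : Lp (ℝ × ℝ) 2 (volume : Measure ℝ)}
    (hZ : HasDerivWithinAt Z Z' I t) {R : ℝ}
    (hR : ∀ᶠ τ in 𝓝[I] t, ∀ᵐ x, ‖Z τ x‖ ≤ R) :
    HasDerivWithinAt (fun τ => ∫ x, P (Z τ x)) (∫ x, fderiv ℝ P (Z t x) (Z' x)) I t := by
  have hRt : ∀ᵐ x, ‖Z t x‖ ≤ R := hR.self_of_nhdsWithin ht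
  have hg := memLp_fderiv_comp hP hP' (Lp.memLp (Z t)) hRt
  have hlin := hasDerivWithinAt_integral_apply hZ hg
  obtain ⟨C, hC0, hC⟩ := exists_taylor_bound hP |R|
  have hint : ∀ Y : Lp (ℝ × ℝ) 2 (volume : Measure ℝ),
      Integrable fun x => fderiv ℝ P (Z t x) (Y x) := fun Y =>
    memLp_one_iff_integrable.1 <| (ContinuousLinearMap.id ℝ ((ℝ × ℝ) →L[ℝ] ℝ)).memLp_of_bilin
      (p := 2) (q := 2) 1 hg (Lp.memLp Y)
  let D : ℝ → ℝ := fun τ => (∫ x, P (Z τ x)) - ∫ x, fderiv ℝ P (Z t x) (Z τ x)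
  have hbound : ∀ᶠ τ in 𝓝[I] t, ‖D τ - D t‖ ≤ C * ‖‖Z τ - Z t‖ ^ 2‖ := by
    filter_upwards [hR] with τ hτ
    have i1 := integrable_comp hP hP0 hP' (Lp.memLp (Z τ)) hτ
    have i2 := integrable_comp hP hP0 hP' (Lp.memLp (Z t)) hRt
    have e1 : D τ - D t = ∫ x, (P (Z τ x) - fderiv ℝ P (Z t x) (Z τ x)) -
        (P (Z t x) - fderiv ℝ P (Z t x) (Z t x)) := by
      have j1 : Integrable fun x => P (Z τ x) - fderiv ℝ P (Z t x) (Z τ x) := i1.sub (hint _)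
      have j2 : Integrable fun x => P (Z t x) - fderiv ℝ P (Z t x) (Z t x) := i2.sub (hint _)
      rw [integral_sub j1 j2, integral_sub i1 (hint _), integral_sub i2 (hint _)]
    have i3 : Integrable fun x => ‖(Z τ - Z t) x‖ ^ 2 :=
      (memLp_two_iff_integrable_sq_norm (Lp.memLp _).1).1 (Lp.memLp _)
    have e2 : ‖Z τ - Z t‖ ^ 2 = ∫ x, ‖(Z τ - Z t) x‖ ^ 2 := norm_sq_eq_integral _
    rw [e1, norm_pow, norm_norm, e2, ← integral_const_mul]
    refine norm_integral_le_of_norm_le (i3.const_mul C) ?_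
    filter_upwards [hτ, hRt, Lp.coeFn_sub (Z τ) (Z t)] with x h1 h2 h3
    have := (hC (Z t x) (by simpa using h2.trans (le_abs_self R)) (Z τ x)
      (by simpa using h1.trans (le_abs_self R))).2
    rw [h3, Pi.sub_apply, Real.norm_eq_abs]
    refine le_trans (le_of_eq ?_) this
    rw [map_sub]
    congr 1
    ring
  have hD : HasDerivWithinAt D 0 I t := by
    rw [hasDerivWithinAt_iff_isLittleO]
    simp only [smul_zero, sub_zero]
    have o1 : (fun τ => Z τ - Z t) =O[𝓝[I] t] fun τ => τ - t := hZ.differentiableWithinAt.isBigO_sub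
    have o2 : (fun τ => D τ - D t) =O[𝓝[I] t] fun τ => (τ - t) ^ 2 :=
      (Asymptotics.IsBigO.of_bound C hbound).trans (o1.norm_left.pow 2)
    refine o2.trans_isLittleO ?_
    have o3 : (fun τ : ℝ => τ - t) =o[𝓝[I] t] fun _ => (1 : ℝ) := by
      rw [Asymptotics.isLittleO_one_iff]
      have : Tendsto (fun τ : ℝ => τ - t) (𝓝 t) (𝓝 (t - t)) :=
        (continuous_id.sub continuous_const).tendsto t
      rw [sub_self] at this
      exact this.mono_left nhdsWithin_le_nhds
    simpa [sq] using o3.mul_isBigO (Asymptotics.isBigO_refl (fun τ : ℝ => τ - t) (𝓝[I] t))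
  have := hD.add hlin
  rw [zero_add] at this
  refine this.congr_of_eventuallyEq (Eventually.of_forall fun τ => ?_) ?_ <;> simp [D]

/-! ### The variational derivative and the weak equation -/

theorem densityPoly_zero (n : ℕ) : densityPoly n 0 = 0 := by
  simp [densityPoly]

/-- `P` is homogeneous of degree `2n + 1 ≥ 3`. -/
theorem fderiv_densityPoly_zero {n : ℕ} (hn : 1 ≤ n) : fderiv ℝ (densityPoly n) 0 = 0 := by
  have h1 : densityPolyFst n 0 0 = 0 := Finset.sum_eq_zero fun k _ => by
    rcases Nat.eq_zero_or_pos k with rfl | hk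
    · simp; right; omega
    · rw [zero_pow (n := 2 * k) (by omega), mul_zero]
  have h2 : densityPolySnd n 0 0 = 0 := Finset.sum_eq_zero fun k _ => by simp
  refine ContinuousLinearMap.ext fun z => ?_
  have h := fderiv_densityPoly n 0 0 z.1 z.2
  rw [h1, h2, zero_mul, zero_mul, add_zero] at h
  exact h

/-- The variational derivative of `H₂`. -/
def variation (n : ℕ) (a b q : ℝ) : ℝ :=
  (a ^ 2 - b ^ 2) ^ n + 2 * n * ((a ^ 2 - b ^ 2) ^ (n - 1) * a * (a - q))

/-- `q` enters linearly, so every term is a bounded factor times an `L²` one. -/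
theorem memLp_variation {n : ℕ} (hn : 1 ≤ n) {u p q : ℝ → ℝ} (huc : Continuous u)
    (hpc : Continuous p) (hu : MemLp u 2 volume) (hp : MemLp p 2 volume)
    (hq : MemLp q 2 volume) {R : ℝ} (huR : ∀ x, |u x| ≤ R) (hpR : ∀ x, |p x| ≤ R) :
    MemLp (fun x => variation n (u x) (p x) (q x)) 2 volume := by
  have hu' : MemLp u ⊤ volume :=
    memLp_top_of_bound huc.aestronglyMeasurable R (Eventually.of_forall huR)
  have hp' : MemLp p ⊤ volume :=
    memLp_top_of_bound hpc.aestronglyMeasurable R (Eventually.of_forall hpR)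
  have hA : MemLp (fun x => (u x ^ 2 - p x ^ 2) ^ (n - 1)) ⊤ volume := by
    refine memLp_top_of_bound (by fun_prop : Continuous _).aestronglyMeasurable
      ((R ^ 2 + R ^ 2) ^ (n - 1)) (Eventually.of_forall fun x => ?_)
    rw [norm_pow]
    gcongr
    refine (norm_sub_le _ _).trans ?_
    simp only [norm_pow, Real.norm_eq_abs]
    gcongr
    · exact huR x
    · exact hpR x
  have key : ∀ f g : ℝ → ℝ, MemLp f ⊤ volume → MemLp g 2 volume →
      MemLp (fun x => f x * g x) 2 volume := fun f g hf hg => hg.mul' hf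
  have h := (key _ _ hA ((key _ _ hu' hu).sub (key _ _ hp' hp))).add
    ((key _ _ hA (key _ _ hu' (hu.sub hq))).const_mul (2 * n))
  refine (memLp_congr_ae (Eventually.of_forall fun x => ?_)).1 h
  obtain ⟨m, rfl⟩ : ∃ m, n = m + 1 := ⟨n - 1, by omega⟩
  simp only [variation, Pi.add_apply, Pi.sub_apply, Nat.add_sub_cancel, pow_succ]
  ring

/-- Integrating `∂_x (u² - u_x²)ⁿ = 2n (u² - u_x²)ⁿ⁻¹ u_x m` by parts puts the nonlinear terms in
divergence form. -/
theorem weak_form_eq {n : ℕ} (hn : 1 ≤ n) {u p q : ℝ → ℝ} (hu : ∀ x, HasDerivAt u (p x) x)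
    (hp : ∀ x, HasDerivAt p (q x) x) (hq : Continuous q) {φ : ℝ → ℝ} (hφ : ContDiff ℝ ∞ φ)
    (hφc : HasCompactSupport φ) :
    -(∫ x, (u x ^ 2 - p x ^ 2) ^ (n - 1) * p x * (u x - q x) * φ x) +
      ∫ x, (u x ^ 2 - p x ^ 2) ^ (n - 1) * u x * (u x - q x) * deriv φ x =
    (2 * n : ℝ)⁻¹ * ∫ x, variation n (u x) (p x) (q x) * deriv φ x := by
  have huc : Continuous u := continuous_iff_continuousAt.2 fun x => (hu x).continuousAt
  have hpc : Continuous p := continuous_iff_continuousAt.2 fun x => (hp x).continuousAt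
  have hd : Continuous (deriv φ) := hφ.continuous_deriv (by simp)
  have hn0 : (n : ℝ) ≠ 0 := by positivity
  have h1 := integral_mul_deriv_testFunction (W := fun x => (u x ^ 2 - p x ^ 2) ^ n)
    (v := fun x => 2 * n * ((u x ^ 2 - p x ^ 2) ^ (n - 1) * p x * (u x - q x)))
    (fun x => by
      convert! (((hu x).pow 2).sub ((hp x).pow 2)).pow n using 1
      simp
      ring) (by fun_prop) hφ hφc
  have h2 : ∫ x, variation n (u x) (p x) (q x) * deriv φ x =
      (∫ x, (u x ^ 2 - p x ^ 2) ^ n * deriv φ x) +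
      2 * n * ∫ x, (u x ^ 2 - p x ^ 2) ^ (n - 1) * u x * (u x - q x) * deriv φ x := by
    rw [← integral_const_mul, ← integral_add
      (integrable_mul_of_hasCompactSupport (by fun_prop) hd hφc.deriv)
      ((integrable_mul_of_hasCompactSupport (by fun_prop) hd hφc.deriv).const_mul _)]
    congr 1; ext x; simp only [variation]; ring
  rw [h2, h1]
  simp_rw [mul_assoc (2 * (n : ℝ))]
  rw [integral_const_mul]
  field_simp

/-! ### Time interval and spatial regularity -/

theorem convex_timeInterval (T : EReal) : Convex ℝ (timeInterval T) := by
  refine Set.OrdConnected.convex ⟨fun x hx y hy z hz => ⟨hx.1.trans hz.1, ?_⟩⟩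
  exact (EReal.coe_le_coe_iff.2 hz.2).trans_lt hy.2

theorem uniqueDiffOn_timeInterval {T : EReal} (hT : 0 < T) :
    UniqueDiffOn ℝ (timeInterval T) := by
  refine uniqueDiffOn_convex (convex_timeInterval T) ?_
  obtain ⟨r, hr0, hrT⟩ := EReal.lt_iff_exists_real_btwn.1 hT
  have hr : 0 < r := by exact_mod_cast hr0
  refine ⟨r / 2, mem_interior.2 ⟨Set.Ioo 0 r, fun x hx => ⟨hx.1.le, ?_⟩, isOpen_Ioo, ?_⟩⟩
  · exact (EReal.coe_lt_coe_iff.2 hx.2).trans hrT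
  · constructor <;> linarith

/-- The spatial regularity of `H^s` functions, `s > 5 / 2`, needed for the energy identity. -/
structure IsRegular (f p q : ℝ → ℝ) : Prop where
  hasDerivAt : ∀ x, HasDerivAt f (p x) x
  hasDerivAt_deriv : ∀ x, HasDerivAt p (q x) x
  continuous : Continuous q
  memLp : MemLp f 2 volume
  memLp_deriv : MemLp p 2 volume
  memLp_deriv_deriv : MemLp q 2 volume
  bounded : ∃ R, ∀ x, |f x| ≤ R ∧ |p x| ≤ R

/-- A continuous second derivative in `L²` is what requires `s > 2 + 1/2`. -/
theorem isRegular_sobolevFun {s : ℝ} (hs : 5 / 2 < s) (G : Lp ℂ 2 (volume : Measure ℝ)) :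
    IsRegular (sobolevFun s 0 G) (sobolevFun s 1 G) (sobolevFun s 2 G) where
  hasDerivAt := hasDerivAt_sobolevFun (by push_cast; linarith) G
  hasDerivAt_deriv := hasDerivAt_sobolevFun (by push_cast; linarith) G
  continuous := continuous_sobolevFun (by push_cast; linarith) G
  memLp := memLp_sobolevFun (by push_cast; linarith) G
  memLp_deriv := memLp_sobolevFun (by push_cast; linarith) G
  memLp_deriv_deriv := memLp_sobolevFun (by push_cast; linarith) G
  bounded := by
    obtain ⟨C, -, hC⟩ := exists_abs_sobolevFun_le (σ := s) (j := 0) (by push_cast; linarith)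
    obtain ⟨D, -, hD⟩ := exists_abs_sobolevFun_le (σ := s) (j := 1) (by push_cast; linarith)
    exact ⟨max (C * ‖G‖) (D * ‖G‖), fun x =>
      ⟨(hC G x).trans (le_max_left _ _), (hD G x).trans (le_max_right _ _)⟩⟩

namespace IsRegular

variable {f p q : ℝ → ℝ}

theorem deriv_eq (hf : IsRegular f p q) : deriv f = p := funext fun x => (hf.hasDerivAt x).deriv

theorem deriv_deriv_eq (hf : IsRegular f p q) : deriv (deriv f) = q := by
  rw [hf.deriv_eq]
  exact funext fun x => (hf.hasDerivAt_deriv x).deriv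

theorem continuous_fun (hf : IsRegular f p q) : Continuous f :=
  continuous_iff_continuousAt.2 fun x => (hf.hasDerivAt x).continuousAt

theorem continuous_deriv (hf : IsRegular f p q) : Continuous p :=
  continuous_iff_continuousAt.2 fun x => (hf.hasDerivAt_deriv x).continuousAt

theorem memLp_pair (hf : IsRegular f p q) : MemLp (fun x => (f x, p x)) 2 volume := by
  refine (hf.memLp.norm.add hf.memLp_deriv.norm).of_le
    (hf.continuous_fun.prodMk hf.continuous_deriv).aestronglyMeasurable
    (Eventually.of_forall fun x => ?_)
  simp only [Prod.norm_mk, Pi.add_apply]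
  rw [Real.norm_of_nonneg (add_nonneg (norm_nonneg (f x)) (norm_nonneg (p x)))]
  exact max_le (le_add_of_nonneg_right (norm_nonneg _)) (le_add_of_nonneg_left (norm_nonneg _))

theorem memLp_fderiv_densityPoly (hf : IsRegular f p q) {n : ℕ} (hn : 1 ≤ n) :
    MemLp (fun x => fderiv ℝ (densityPoly n) (f x, p x)) 2 volume := by
  obtain ⟨R, hR⟩ := hf.bounded
  exact memLp_fderiv_comp (contDiff_densityPoly n) (fderiv_densityPoly_zero hn) hf.memLp_pair
    (Eventually.of_forall fun x => max_le (hR x).1 (hR x).2)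

theorem integrable_H2density (hf : IsRegular f p q) {n : ℕ} (hn : 1 ≤ n) :
    Integrable (H2density n f) := by
  obtain ⟨R, hR⟩ := hf.bounded
  have := integrable_comp (contDiff_densityPoly n) (densityPoly_zero n)
    (fderiv_densityPoly_zero hn) hf.memLp_pair
    (Eventually.of_forall fun x => max_le (hR x).1 (hR x).2)
  refine this.congr (Eventually.of_forall fun x => ?_)
  rw [H2density_eq, hf.deriv_eq]

theorem memLp_densityPolyFst (hf : IsRegular f p q) {n : ℕ} (hn : 1 ≤ n) :
    MemLp (fun x => densityPolyFst n (f x) (p x)) 2 volume := by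
  have h := (ContinuousLinearMap.apply ℝ ℝ ((1, 0) : ℝ × ℝ)).comp_memLp'
    (hf.memLp_fderiv_densityPoly hn)
  refine (memLp_congr_ae (Eventually.of_forall fun x => ?_)).1 h
  simp [fderiv_densityPoly]

theorem memLp_densityPolySnd (hf : IsRegular f p q) {n : ℕ} (hn : 1 ≤ n) :
    MemLp (fun x => densityPolySnd n (f x) (p x)) 2 volume := by
  have h := (ContinuousLinearMap.apply ℝ ℝ ((0, 1) : ℝ × ℝ)).comp_memLp'
    (hf.memLp_fderiv_densityPoly hn)
  refine (memLp_congr_ae (Eventually.of_forall fun x => ?_)).1 h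
  simp [fderiv_densityPoly]

/-- The first variation of `H₂`. -/
theorem integral_fderiv_densityPoly (hf : IsRegular f p q) {n : ℕ} (hn : 1 ≤ n) {v v' : ℝ → ℝ}
    (hv : ∀ x, HasDerivAt v (v' x) x) (hv2 : MemLp v 2 volume) (hv'2 : MemLp v' 2 volume) :
    ∫ x, fderiv ℝ (densityPoly n) (f x, p x) (v x, v' x) =
      ∫ x, variation n (f x) (p x) (q x) * v x := by
  obtain ⟨R, hR⟩ := hf.bounded
  have hE := memLp_variation hn hf.continuous_fun hf.continuous_deriv hf.memLp hf.memLp_deriv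
    hf.memLp_deriv_deriv (fun x => (hR x).1) (fun x => (hR x).2)
  have hA := hf.memLp_densityPolyFst hn
  have hB := hf.memLp_densityPolySnd hn
  have i1 : Integrable fun x => densityPolyFst n (f x) (p x) * v x := hA.integrable_mul hv2
  have i2 : Integrable fun x => densityPolySnd n (f x) (p x) * v' x := hB.integrable_mul hv'2
  have i3 : Integrable fun x => variation n (f x) (p x) (q x) * v x := hE.integrable_mul hv2
  have hparts := integral_mul_deriv_eq_deriv_mul_of_integrable
    (u := fun x => densityPolySnd n (f x) (p x))
    (u' := fun x => densityPolyFst n (f x) (p x) - variation n (f x) (p x) (q x))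
    (fun x _ => hasDerivAt_densityPolySnd hn (hf.hasDerivAt x) (hf.hasDerivAt_deriv x))
    (fun x _ => hv x) i2 ((hA.sub hE).integrable_mul hv2) (hB.integrable_mul hv2)
  simp_rw [fderiv_densityPoly]
  rw [integral_add i1 i2, hparts]
  simp_rw [sub_mul]
  rw [integral_sub i1 i3]
  ring

/-- Only the pair `(u, u_x)`, whose time derivative exists in `L²`, appears on the right. -/
theorem integral_momentum_mul (hf : IsRegular f p q) {φ : ℝ → ℝ} (hφ : ContDiff ℝ ∞ φ)
    (hφc : HasCompactSupport φ) :
    ∫ x, momentum f x * φ x = ∫ x, φ x * f x + deriv φ x * p x := by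
  have hd : Continuous (deriv φ) := hφ.continuous_deriv (by simp)
  have h1 := integral_mul_deriv_testFunction hf.hasDerivAt_deriv hf.continuous hφ hφc
  have i1 := integrable_mul_of_hasCompactSupport hf.continuous_fun hφ.continuous hφc
  have i2 := integrable_mul_of_hasCompactSupport hf.continuous hφ.continuous hφc
  have i3 := integrable_mul_of_hasCompactSupport hf.continuous_deriv hd hφc.deriv
  simp_rw [momentum, hf.deriv_deriv_eq, sub_mul, mul_comm (φ _), mul_comm (deriv φ _)]
  rw [integral_sub i1 i2, integral_add i1 i3, h1]
  ring

end IsRegular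

/-! ### Conservation of `H₂` -/

/-- `H₂` has zero time derivative along strong solutions. -/
theorem IsStrongSolution.hasDerivWithinAt_H2 {n : ℕ} (hn : 1 ≤ n) {s : ℝ} (hs : 5 / 2 < s)
    {T : EReal} (hT : 0 < T) {u : ℝ → ℝ → ℝ} (hu : IsStrongSolution n s T u)
    {p q : ℝ → ℝ → ℝ} (hreg : ∀ t ∈ timeInterval T, IsRegular (u t) (p t) (q t))
    {t : ℝ} (ht : t ∈ timeInterval T) :
    HasDerivWithinAt (fun τ => H2 n (u τ)) 0 (timeInterval T) t := by
  obtain ⟨F, hF, hFu⟩ := hu.contDiff_Hs_sub_one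
  have hσ : 3 / 2 < s - 1 := by linarith
  have hσ1 : 1 ≤ s - 1 := by linarith
  have hu0 : ∀ τ ∈ timeInterval T, u τ = sobolevFun (s - 1) 0 (F τ) := fun τ hτ => by
    obtain ⟨h, hb⟩ := hFu τ hτ
    exact eq_sobolevFun (by linarith) (hu.continuous_space τ hτ) h hb
  have hu1 : ∀ τ ∈ timeInterval T, p τ = sobolevFun (s - 1) 1 (F τ) := fun τ hτ => by
    rw [← (hreg τ hτ).deriv_eq, hu0 τ hτ]
    exact funext fun x => (hasDerivAt_sobolevFun (by push_cast; linarith) (F τ) x).deriv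
  have hF' : HasDerivWithinAt F (derivWithin F (timeInterval T) t) (timeInterval T) t :=
    ((hF.differentiableOn (by norm_num)) t ht).hasDerivWithinAt
  set F' := derivWithin F (timeInterval T) t
  let v := sobolevFun (s - 1) 0 F'
  let v' := sobolevFun (s - 1) 1 F'
  have hv : ∀ x, HasDerivAt v (v' x) x := hasDerivAt_sobolevFun (by push_cast; linarith) F'
  have hv2 : MemLp v 2 volume := memLp_sobolevFun (by push_cast; linarith) F'
  have hv'2 : MemLp v' 2 volume := memLp_sobolevFun (by push_cast; linarith) F'
  have hv'c : Continuous v' := continuous_sobolevFun (by push_cast; linarith) F'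
  have hvc : Continuous v := continuous_sobolevFun (by push_cast; linarith) F'
  let Z : ℝ → Lp (ℝ × ℝ) 2 (volume : Measure ℝ) := fun τ => sobolevPair (s - 1) hσ1 (F τ)
  have hZ : HasDerivWithinAt Z (sobolevPair (s - 1) hσ1 F') (timeInterval T) t :=
    (sobolevPair (s - 1) hσ1).hasFDerivAt.comp_hasDerivWithinAt t hF'
  have hZu : ∀ τ ∈ timeInterval T, Z τ =ᵐ[volume] fun x => (u τ x, p τ x) := fun τ hτ => by
    rw [hu0 τ hτ, hu1 τ hτ]
    exact coeFn_sobolevPair hσ1 hσ (F τ)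
  have hZ' : sobolevPair (s - 1) hσ1 F' =ᵐ[volume] fun x => (v x, v' x) :=
    coeFn_sobolevPair hσ1 hσ F'
  have hweak : ∀ φ : ℝ → ℝ, ContDiff ℝ ∞ φ → HasCompactSupport φ →
      (∫ x, v x * φ x) + (∫ x, v' x * deriv φ x) =
        (2 * n : ℝ)⁻¹ * ∫ x, variation n (u t x) (p t x) (q t x) * deriv φ x := by
    intro φ hφ hφc
    have hd : Continuous (deriv φ) := hφ.continuous_deriv (by simp)
    have heq := hu.equation t ht φ hφ hφc
    have hg : MemLp (fun x => φ x • ContinuousLinearMap.fst ℝ ℝ ℝ +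
        deriv φ x • ContinuousLinearMap.snd ℝ ℝ ℝ) 2 volume :=
      (by fun_prop : Continuous _).memLp_of_hasCompactSupport
        (hφc.smul_right.add hφc.deriv.smul_right)
    have hder := hasDerivWithinAt_integral_apply hZ hg
    have hder' := hder.congr (f₁ := fun τ => ∫ x, momentum (u τ) x * φ x)
      (fun τ hτ => ?_) ?_
    rotate_left
    · rw [(hreg τ hτ).integral_momentum_mul hφ hφc]
      refine integral_congr_ae ?_
      filter_upwards [hZu τ hτ] with x hx
      simp [hx]
    · rw [(hreg t ht).integral_momentum_mul hφ hφc]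
      refine integral_congr_ae ?_
      filter_upwards [hZu t ht] with x hx
      simp [hx]
    -- The tested momentum has one derivative from the `L²` curve and one from the equation; they
    -- agree, also at `t = 0`, because `T > 0`.
    have huniq := (uniqueDiffOn_timeInterval hT t ht).eq_deriv _ hder' heq
    have hreg' := hreg t ht
    rw [← weak_form_eq hn hreg'.hasDerivAt hreg'.hasDerivAt_deriv hreg'.continuous hφ hφc]
    simp only [momentum, hreg'.deriv_deriv_eq] at huniq
    rw [hreg'.deriv_eq] at huniq
    rw [← huniq, ← integral_add (integrable_mul_of_hasCompactSupport hvc hφ.continuous hφc)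
      (integrable_mul_of_hasCompactSupport hv'c hd hφc.deriv)]
    refine integral_congr_ae ?_
    filter_upwards [hZ'] with x hx
    rw [hx]
    simp [mul_comm]
  obtain ⟨C, hC0, hC⟩ := exists_abs_sobolevFun_le (σ := s - 1) (j := 0) (by push_cast; linarith)
  obtain ⟨D, hD0, hD⟩ := exists_abs_sobolevFun_le (σ := s - 1) (j := 1) (by push_cast; linarith)
  -- Continuity keeps `‖F τ‖` below `‖F t‖ + 1` near `t`, and the embedding turns this into a sup
  -- bound.
  have hbound : ∀ᶠ τ in 𝓝[timeInterval T] t,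
      ∀ᵐ x, ‖Z τ x‖ ≤ max C D * (‖F t‖ + 1) := by
    have hFc : Tendsto (fun τ => ‖F τ‖) (𝓝[timeInterval T] t) (𝓝 ‖F t‖) :=
      hF'.continuousWithinAt.norm
    filter_upwards [hFc.eventually_le_const (lt_add_one ‖F t‖)] with τ hτ
    filter_upwards [coeFn_sobolevPair hσ1 hσ (F τ)] with x hx
    change ‖(sobolevPair (s - 1) hσ1 (F τ)) x‖ ≤ _
    rw [hx]
    refine max_le ((hC _ x).trans ?_) ((hD _ x).trans ?_)
    · exact mul_le_mul (le_max_left _ _) hτ (norm_nonneg _) (hC0.trans (le_max_left _ _))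
    · exact mul_le_mul (le_max_right _ _) hτ (norm_nonneg _) (hC0.trans (le_max_left _ _))
  have hH := hasDerivWithinAt_integral_comp (contDiff_densityPoly n) (densityPoly_zero n)
    (fderiv_densityPoly_zero hn) ht hZ hbound
  have hH2 : ∀ τ ∈ timeInterval T, H2 n (u τ) = ∫ x, densityPoly n (Z τ x) := fun τ hτ => by
    refine integral_congr_ae ?_
    filter_upwards [hZu τ hτ] with x hx
    rw [hx, H2density_eq, (hreg τ hτ).deriv_eq]
  have hzero : ∫ x, fderiv ℝ (densityPoly n) (Z t x) (sobolevPair (s - 1) hσ1 F' x) = 0 := by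
    have hreg' := hreg t ht
    obtain ⟨R, hR⟩ := hreg'.bounded
    have e : ∫ x, fderiv ℝ (densityPoly n) (Z t x) (sobolevPair (s - 1) hσ1 F' x) =
        ∫ x, fderiv ℝ (densityPoly n) (u t x, p t x) (v x, v' x) := by
      refine integral_congr_ae ?_
      filter_upwards [hZu t ht, hZ'] with x h1 h2
      rw [h1, h2]
    have hn0 : (n : ℝ) ≠ 0 := by positivity
    have hvarc : Continuous fun x => variation n (u t x) (p t x) (q t x) := by
      have h1 := hreg'.continuous_fun
      have h2 := hreg'.continuous_deriv
      have h3 := hreg'.continuous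
      unfold variation
      fun_prop
    rw [e, hreg'.integral_fderiv_densityPoly hn hv hv2 hv'2]
    exact integral_mul_eq_zero_of_weak_eq (by positivity) hv hv'c hvarc hv2 hv'2
      (memLp_variation hn hreg'.continuous_fun hreg'.continuous_deriv hreg'.memLp
        hreg'.memLp_deriv hreg'.memLp_deriv_deriv (fun x => (hR x).1) (fun x => (hR x).2)) hweak
  rw [hzero] at hH
  exact hH.congr hH2 (hH2 t ht)

end HOCH

end

theorem mainTheorem4 (n : ℕ) (hn : 1 ≤ n) (s : ℝ) (hs : 5 / 2 < s) (T : EReal) (hT : 0 < T)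
    (u : ℝ → ℝ → ℝ) (hu : HOCH.IsStrongSolution n s T u) :
    ∀ t ∈ HOCH.timeInterval T,
      MeasureTheory.Integrable (HOCH.H2density n (u t)) MeasureTheory.volume ∧
        HOCH.H2 n (u t) = HOCH.H2 n (u 0) := by
  obtain ⟨F, -, hFu⟩ := hu.continuous_Hs
  have hreg : ∀ t ∈ HOCH.timeInterval T, HOCH.IsRegular (u t) (HOCH.sobolevFun s 1 (F t))
      (HOCH.sobolevFun s 2 (F t)) := fun t ht => by
    obtain ⟨h, hb⟩ := hFu t ht
    rw [HOCH.eq_sobolevFun (by linarith) (hu.continuous_space t ht) h hb]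
    exact HOCH.isRegular_sobolevFun hs (F t)
  intro t ht
  refine ⟨(hreg t ht).integrable_H2density hn, ?_⟩
  have h0 : (0 : ℝ) ∈ HOCH.timeInterval T := ⟨le_rfl, by simpa using hT⟩
  -- Mean value inequality with derivative bound `0`.
  have h := (HOCH.convex_timeInterval T).norm_image_sub_le_of_norm_hasDerivWithin_le (C := 0)
    (fun τ hτ => hu.hasDerivWithinAt_H2 hn hs hT hreg hτ) (fun τ _ => by simp) h0 ht
  rw [zero_mul, norm_le_zero_iff, sub_eq_zero] at h
  exact h
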